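/- Let $\mathcal H=\bigotimes_{k=1}^N\mathcal H_k$ be a tensor product of finite-dimensional complex Hilbert spaces, and let $\{G_k^a\}_a$ be, for each $k$, a family of linear operators (not necessarily Hermitian) on $\mathcal H_k$, indexed by a finite set of labels $a$ that does not depend on $k$. Put $$G^a=\sum_{k=1}^N G_k^a\otimes\bigotimes_{\ell\ne k}I_\ell .$$ Let $\rho$ be any density matrix on $\mathcal H$ (pure or mixed). For each $k$ let $\rho_k$ be its reduced density matrix on $\mathcal H_k$ (the partial trace over all other factors), and let $s_k=-\mathrm{Tr}[\rho_k\ln\rho_k]$ be the von Neumann entropy of $\rho_k$. For an operator $X$ on $\mathcal H$ write $\mathrm{Var}(X)=\mathrm{Tr}[\rho X^\dagger X]-|\mathrm{Tr}[\rho X]|^2$. Then $$\sum_a\mathrm{Var}(G^a)\;\le\;\operatorname{Avg}_k\!\left(D_k^2\right)\left(N+2N^2\sqrt{\operatorname{Avg}_k(s_k)}\right),\qquad D_k^2=\Big\|\sum_a (G_k^a)^\dagger G_k^a\Big\|_\infty ,$$ where $\|M\|_\infty$ is the Schatten $\infty$-norm (the largest eigenvalue of $\sqrt{M^\dagger M}$)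 and $\operatorname{Avg}_k(x_k)=\frac1N\sum_{k=1}^N x_k$. -/

import Mathlib

noncomputable section

namespace MultipartiteQuantum

open scoped Matrix ComplexOrder

/-- The Schatten `∞`-norm: the largest eigenvalue of `|M| = √(M† M)`. -/
def schattenInftyNorm {n : Type*} [Fintype n] [DecidableEq n] (M : Matrix n n ℂ) : ℝ :=
  sSup (spectrum ℝ (cfc Real.sqrt (Mᴴ * M)))

/-- A density matrix: positive semidefinite with unit trace. -/
structure IsDensityMatrix {n : Type*} [Fintype n] (ρ : Matrix n n ℂ) : Prop where
  posSemidef : ρ.PosSemidef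
  trace_eq_one : ρ.trace = 1

/-- The von Neumann entropy `-Tr[ρ ln ρ]` (natural logarithm, `0 ln 0 = 0`). The trace is real
for Hermitian `ρ`. -/
def vonNeumannEntropy {n : Type*} [Fintype n] [DecidableEq n] (ρ : Matrix n n ℂ) : ℝ :=
  -(ρ * cfc Real.log ρ).trace.re

/-- The variance `Tr[ρ G† G] - |Tr[ρ G]|²` of a (not necessarily Hermitian) operator `G` in the
state `ρ`. The first trace is real for positive semidefinite `ρ`. -/
def variance {n : Type*} [Fintype n] (ρ G : Matrix n n ℂ) : ℝ :=
  (ρ * Gᴴ * G).trace.re - ‖(ρ * G).trace‖ ^ 2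

/-- The average of `x 1, …, x N`. -/
def avg {N : ℕ} (x : Fin N → ℝ) : ℝ := (∑ k, x k) / N

section Tensor

variable {N : ℕ} {ι : Fin N → Type*}

/-- The tensor product `⨂ₖ Aₖ` of operators on `ℋₖ = ℂ^(ι k)`. It is an operator on
`⨂ₖ ℋₖ = ℂ^(∏ₖ ι k)`, in the product basis. -/
def tensorOp (A : ∀ k, Matrix (ι k) (ι k) ℂ) : Matrix (∀ k, ι k) (∀ k, ι k) ℂ :=
  Matrix.of fun f g => ∏ k, A k (f k) (g k)

/-- The operator `A ⊗ ⨂_{ℓ ≠ k} I_ℓ` that acts as `A` on the `k`-th factor. -/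
def localOp [∀ k, DecidableEq (ι k)] (k : Fin N) (A : Matrix (ι k) (ι k) ℂ) :
    Matrix (∀ k, ι k) (∀ k, ι k) ℂ :=
  tensorOp (Function.update (fun l => (1 : Matrix (ι l) (ι l) ℂ)) k A)

/-- The reduced matrix `ρₖ` on the `k`-th factor: the partial trace of `ρ` over all other factors.
Its `(i, j)` entry sums `ρ f g` over all `f`, `g` that agree off `k` and have `f k = i`,
`g k = j`. -/
def reducedState [∀ k, Fintype (ι k)] [∀ k, DecidableEq (ι k)]
    (ρ : Matrix (∀ k, ι k) (∀ k, ι k) ℂ) (k : Fin N) : Matrix (ι k) (ι k) ℂ :=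
  Matrix.of fun i j => ∑ f : ∀ l, ι l with f k = i, ρ f (Function.update f k j)

end Tensor

end MultipartiteQuantum

end

noncomputable section

namespace MultipartiteQuantum

open scoped Matrix ComplexOrder

/-! ### Local operators and reduced states. -/

section LocalOp

variable {N : ℕ} {ι : Fin N → Type*}

/-! Write `ρ = S S†`. The summed variance is then the squared norm of `∑ k, u k`, where `u k` is the
vector of the centered local family of factor `k` (`norm_hsVec_centered_sq`). The diagonal terms `‖u
k‖²` are at most `d k = D_k²`; everything else is a bound on covariances of distinct factors.

If `ρ_k` is nearly pure, factor `k` is nearly uncorrelated with the rest. Let `p` project onto a top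
eigenvector of `ρ_k`, with `ε` the weight outside it. Up to terms of relative size `√ε`, `p`
compresses operators on factor `k` to scalars, and scalars have no covariance with anything. This
gives a covariance of at most `3 √ε √(d k) √(d l)` (`norm_inner_centered_le`). By `entropy_ge`,
either `3 √ε ≤ 2 √s_k`, or `2 √s_k ≥ 1` and Cauchy–Schwarz suffices, so `2 √s_k` serves in both
cases (`norm_inner_localOp_le`).

Summing over pairs by AM-GM and Cauchy–Schwarz (`norm_sum_sq_le`) turns this into averages. -/

lemma tensorOp_mul [∀ k, Fintype (ι k)] (A B : ∀ k, Matrix (ι k) (ι k) ℂ) :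
    tensorOp A * tensorOp B = tensorOp fun k => A k * B k := by
  ext f g
  simp only [tensorOp, Matrix.mul_apply, Matrix.of_apply, ← Finset.prod_mul_distrib]
  rw [Finset.prod_univ_sum, Fintype.piFinset_univ]

variable [∀ k, DecidableEq (ι k)]

lemma localOp_apply (k : Fin N) (A : Matrix (ι k) (ι k) ℂ) (f g : ∀ k, ι k) :
    localOp k A f g = A (f k) (g k) *
      ∏ l ∈ Finset.univ.erase k, (1 : Matrix (ι l) (ι l) ℂ) (f l) (g l) := by
  simp only [localOp, tensorOp, Matrix.of_apply]
  rw [← Finset.mul_prod_erase _ _ (Finset.mem_univ k), Function.update_self]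
  congr 1
  refine Finset.prod_congr rfl fun l hl => ?_
  rw [Function.update_of_ne (Finset.ne_of_mem_erase hl)]

lemma localOp_one (k : Fin N) : localOp k (1 : Matrix (ι k) (ι k) ℂ) = 1 := by
  ext f g
  simp only [localOp, Function.update_eq_self_iff.mpr rfl, tensorOp, Matrix.of_apply,
    Matrix.one_apply, Finset.prod_ite_zero, Finset.prod_const_one, Finset.mem_univ, true_implies,
    funext_iff]

lemma localOp_sub (k : Fin N) (A B : Matrix (ι k) (ι k) ℂ) :
    localOp k (A - B) = localOp k A - localOp k B := by
  ext f g
  simp [localOp_apply, sub_mul]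

lemma localOp_smul (k : Fin N) (c : ℂ) (A : Matrix (ι k) (ι k) ℂ) :
    localOp k (c • A) = c • localOp k A := by
  ext f g
  simp [localOp_apply, mul_assoc]

lemma localOp_sum {α : Type*} (s : Finset α) (k : Fin N) (A : α → Matrix (ι k) (ι k) ℂ) :
    localOp k (∑ a ∈ s, A a) = ∑ a ∈ s, localOp k (A a) := by
  ext f g
  simp [localOp_apply, Matrix.sum_apply, Finset.sum_mul]

lemma localOp_conjTranspose (k : Fin N) (A : Matrix (ι k) (ι k) ℂ) :
    localOp k Aᴴ = (localOp k A)ᴴ := by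
  ext f g
  simp only [localOp_apply, Matrix.conjTranspose_apply, star_mul', Complex.star_def, map_prod]
  congr 1
  refine Finset.prod_congr rfl fun l _ => ?_
  simp [Matrix.one_apply, eq_comm, apply_ite]

variable [∀ k, Fintype (ι k)]

lemma localOp_mul (k : Fin N) (A B : Matrix (ι k) (ι k) ℂ) :
    localOp k (A * B) = localOp k A * localOp k B := by
  rw [localOp, localOp, localOp, tensorOp_mul]
  congr 1
  funext l
  rcases eq_or_ne l k with rfl | h <;> simp [*]

lemma localOp_commute {k l : Fin N} (h : k ≠ l) (A : Matrix (ι k) (ι k) ℂ)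
    (B : Matrix (ι l) (ι l) ℂ) : Commute (localOp k A) (localOp l B) := by
  rw [Commute, SemiconjBy, localOp, localOp, tensorOp_mul, tensorOp_mul]
  congr 1
  funext m
  rcases eq_or_ne m k with rfl | hk
  · simp [h]
  · simp [hk]

open scoped MatrixOrder in
/-- A positive semidefinite matrix has a factorization `S S†`. -/
lemma exists_eq_mul_conjTranspose {n : Type*} [Fintype n] [DecidableEq n] {A : Matrix n n ℂ}
    (hA : A.PosSemidef) : ∃ S : Matrix n n ℂ, A = S * Sᴴ := by
  have h : CFC.sqrt A * CFC.sqrt A = A := CFC.sqrt_mul_sqrt_self A hA.nonneg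
  have h2 : (CFC.sqrt A).IsHermitian := (Matrix.nonneg_iff_posSemidef.mp (CFC.sqrt_nonneg A)).1
  exact ⟨_, by rw [h2.eq, h]⟩

lemma localOp_posSemidef (k : Fin N) {A : Matrix (ι k) (ι k) ℂ} (hA : A.PosSemidef) :
    (localOp k A).PosSemidef := by
  obtain ⟨S, rfl⟩ := exists_eq_mul_conjTranspose hA
  rw [localOp_mul, localOp_conjTranspose]
  exact Matrix.posSemidef_self_mul_conjTranspose _

/-- The reduced state determines the expectations of local operators. -/
lemma trace_mul_localOp (ρ : Matrix (∀ k, ι k) (∀ k, ι k) ℂ) (k : Fin N)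
    (A : Matrix (ι k) (ι k) ℂ) : (ρ * localOp k A).trace = (reducedState ρ k * A).trace := by
  have h1 : ∀ f : ∀ l, ι l, (ρ * localOp k A) f f =
      ∑ j, ρ f (Function.update f k j) * A j (f k) := by
    intro f
    rw [Matrix.mul_apply]
    have hinj : Function.Injective fun j => Function.update f k j := Function.update_injective f k
    rw [← Finset.sum_subset (Finset.subset_univ (Finset.univ.map ⟨_, hinj⟩))]
    · rw [Finset.sum_map]
      refine Finset.sum_congr rfl fun j _ => ?_
      simp only [Function.Embedding.coeFn_mk, localOp_apply, Function.update_self]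
      rw [Finset.prod_eq_one, mul_one]
      intro l hl
      rw [Function.update_of_ne (Finset.ne_of_mem_erase hl), Matrix.one_apply_eq]
    · intro g _ hg
      have : ∃ l, l ≠ k ∧ g l ≠ f l := by
        by_contra! hcon
        refine hg (Finset.mem_map.mpr ⟨g k, Finset.mem_univ _, ?_⟩)
        funext l
        rcases eq_or_ne l k with rfl | hl
        · simp
        · simp [hl, hcon l hl]
      obtain ⟨l, hl, hne⟩ := this
      have hz : localOp k A g f = 0 := by
        rw [localOp_apply]
        exact mul_eq_zero_of_right _ (Finset.prod_eq_zero
          (Finset.mem_erase.mpr ⟨hl, Finset.mem_univ l⟩) (Matrix.one_apply_ne hne))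
      rw [hz, mul_zero]
  simp only [Matrix.trace, Matrix.diag_apply, h1]
  rw [← Finset.sum_fiberwise (s := Finset.univ) (g := fun f : ∀ l, ι l => f k)]
  refine Finset.sum_congr rfl fun i _ => ?_
  simp only [Matrix.mul_apply, reducedState, Matrix.of_apply, Finset.sum_mul]
  rw [Finset.sum_comm]
  refine Finset.sum_congr rfl fun j _ => Finset.sum_congr rfl fun f hf => ?_
  rw [(Finset.mem_filter.mp hf).2]

lemma reducedState_posSemidef {ρ : Matrix (∀ k, ι k) (∀ k, ι k) ℂ} (hρ : ρ.PosSemidef)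
    (k : Fin N) : (reducedState ρ k).PosSemidef := by
  rcases isEmpty_or_nonempty (ι k) with h | ⟨⟨i₀⟩⟩
  · rw [Subsingleton.elim (reducedState ρ k) 0]
    exact Matrix.PosSemidef.zero
  -- Pinning the `k`-th coordinate to a reference value `i₀` indexes the other coordinates
  -- independently of `i`, so the partial trace becomes a sum of principal submatrices.
  have : reducedState ρ k = ∑ f : ∀ l, ι l with f k = i₀,
      ρ.submatrix (fun i => Function.update f k i) (fun i => Function.update f k i) := by
    ext i j
    simp only [reducedState, Matrix.of_apply, Matrix.sum_apply, Matrix.submatrix_apply]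
    refine Finset.sum_bij' (fun f _ => Function.update f k i₀) (fun f _ => Function.update f k i)
      ?_ ?_ ?_ ?_ ?_ <;> simp +contextual [eq_comm]
  rw [this]
  exact Matrix.posSemidef_sum _ fun f _ => hρ.submatrix _

lemma IsDensityMatrix.reducedState {ρ : Matrix (∀ k, ι k) (∀ k, ι k) ℂ} (hρ : IsDensityMatrix ρ)
    (k : Fin N) : IsDensityMatrix (reducedState ρ k) := by
  refine ⟨reducedState_posSemidef hρ.posSemidef k, ?_⟩
  have := trace_mul_localOp ρ k 1
  rw [localOp_one, mul_one, mul_one, hρ.trace_eq_one] at this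
  exact this.symm

end LocalOp

/-! ### The Schatten norm as an operator bound. -/

lemma nonneg_of_mem_spectrum {n : Type*} [Fintype n] [DecidableEq n] {M : Matrix n n ℂ}
    (hM : M.PosSemidef) {x : ℝ} (hx : x ∈ spectrum ℝ M) : 0 ≤ x := by
  rw [hM.1.spectrum_real_eq_range_eigenvalues] at hx
  obtain ⟨i, rfl⟩ := hx
  exact hM.eigenvalues_nonneg i

lemma schattenInftyNorm_eq {n : Type*} [Fintype n] [DecidableEq n] {M : Matrix n n ℂ}
    (hM : M.PosSemidef) : schattenInftyNorm M = sSup (spectrum ℝ M) := by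
  have hs : IsSelfAdjoint M := hM.1
  have h1 : cfc (fun x : ℝ => x ^ 2) M = Mᴴ * M := by
    rw [cfc_pow_id (R := ℝ) M 2, hM.1.eq, sq]
  have h2 : cfc Real.sqrt (Mᴴ * M) = M := by
    rw [← h1, ← cfc_comp' Real.sqrt (fun x : ℝ => x ^ 2) M
      Real.continuous_sqrt.continuousOn (by fun_prop)]
    conv_rhs => rw [← cfc_id' ℝ M]
    refine cfc_congr fun x hx => ?_
    exact Real.sqrt_sq (nonneg_of_mem_spectrum hM hx)
  rw [schattenInftyNorm, h2]

lemma schattenInftyNorm_nonneg {n : Type*} [Fintype n] [DecidableEq n] {M : Matrix n n ℂ}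
    (hM : M.PosSemidef) : 0 ≤ schattenInftyNorm M := by
  rw [schattenInftyNorm_eq hM]
  exact Real.sSup_nonneg fun x hx => nonneg_of_mem_spectrum hM hx

lemma schattenInftyNorm_smul_one_sub_posSemidef {n : Type*} [Fintype n] [DecidableEq n]
    {M : Matrix n n ℂ} (hM : M.PosSemidef) :
    (((schattenInftyNorm M : ℝ) : ℂ) • (1 : Matrix n n ℂ) - M).PosSemidef := by
  have e : ((schattenInftyNorm M : ℝ) : ℂ) • (1 : Matrix n n ℂ) =
      algebraMap ℝ _ (schattenInftyNorm M) := by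
    rw [Algebra.algebraMap_eq_smul_one]
    ext i j
    simp
  rw [e]
  have hH : (algebraMap ℝ (Matrix n n ℂ) (schattenInftyNorm M) - M).IsHermitian :=
    (IsSelfAdjoint.algebraMap _ (.all _)).sub hM.1
  refine hH.posSemidef_iff_eigenvalues_nonneg.mpr fun i => ?_
  have hi := hH.eigenvalues_mem_spectrum_real i
  rw [← spectrum.singleton_sub_eq] at hi
  obtain ⟨_, rfl, x, hx, h⟩ := hi
  rw [Pi.zero_apply, ← h]
  refine sub_nonneg.mpr ?_
  rw [schattenInftyNorm_eq hM]
  exact le_csSup Matrix.finite_real_spectrum.bddAbove hx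

/-! ### Entropy and the weight outside a top eigenvector. -/

/-- The Shannon entropy `s` of a finite distribution bounds the weight `ε` outside a largest
outcome: `s ≥ 1/4` or `s ≥ 9ε/4`. -/
lemma entropy_ge {n : Type*} [Fintype n] [DecidableEq n] {x : n → ℝ} (h0 : ∀ j, 0 ≤ x j)
    (h1 : ∑ j, x j = 1) {i : n} (hi : ∀ j, x j ≤ x i) :
    1 / 4 ≤ -∑ j, x j * Real.log (x j) ∨ 9 * (1 - x i) ≤ 4 * -∑ j, x j * Real.log (x j) := by
  have hsum : ∑ j ∈ Finset.univ.erase i, x j = 1 - x i := by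
    rw [← h1, ← Finset.add_sum_erase _ _ (Finset.mem_univ i)]; ring
  have hle : ∀ j ≠ i, x j ≤ 1 - x i := fun j hj => by
    rw [← hsum]
    exact Finset.single_le_sum (fun k _ => h0 k) (by simp [hj])
  have hε : 0 ≤ 1 - x i := hsum ▸ Finset.sum_nonneg fun k _ => h0 k
  have hlog : ∀ j, x j * (1 - x j) ≤ -(x j * Real.log (x j)) := fun j => by
    rcases (h0 j).eq_or_lt with h | h
    · simp [← h]
    · have := Real.log_le_sub_one_of_pos h
      nlinarith
  rw [← Finset.sum_neg_distrib]
  have hfirst : 1 - x i ≤ ∑ j, -(x j * Real.log (x j)) := by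
    calc 1 - x i = ∑ j, x j * (1 - x i) := by rw [← Finset.sum_mul, h1, one_mul]
      _ ≤ _ := Finset.sum_le_sum fun j _ => (mul_le_mul_of_nonneg_left (by linarith [hi j])
          (h0 j)).trans (hlog j)
  -- With `ε = 1 - x i`, every outcome other than `i` has probability at most `ε ≤ δ`, hence
  -- surprisal at least `c`; outcome `i` contributes at least `x i * ε`.
  have hgen : ∀ δ c : ℝ, 1 - x i ≤ δ → c ≤ -Real.log δ →
      (1 - x i) * c + x i * (1 - x i) ≤ ∑ j, -(x j * Real.log (x j)) := by
    intro δ c hδ hc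
    rw [← Finset.add_sum_erase _ _ (Finset.mem_univ i), add_comm]
    refine add_le_add (hlog i) ?_
    rw [← hsum, Finset.sum_mul]
    refine Finset.sum_le_sum fun j hj => ?_
    rcases (h0 j).eq_or_lt with h | h
    · simp [← h]
    · have := Real.log_le_log h ((hle j (Finset.ne_of_mem_erase hj)).trans hδ)
      nlinarith
  rw [or_iff_not_imp_left, not_le]
  intro hs
  have l2 := Real.log_two_gt_d9
  have l4 : Real.log (1 / 4) = -(2 * Real.log 2) := by
    rw [one_div, Real.log_inv, show (4 : ℝ) = 2 ^ 2 by norm_num, Real.log_pow]; norm_num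
  have l8 : Real.log (1 / 8) = -(3 * Real.log 2) := by
    rw [one_div, Real.log_inv, show (8 : ℝ) = 2 ^ 3 by norm_num, Real.log_pow]; norm_num
  -- Bootstrap: `hfirst` gives `ε < 1/4`, which alone yields too small a factor. But `s ≥ ε (2.38 -
  -- ε)` with `s < 1/4` forces `ε ≤ 1/8`, and then `s ≥ ε (3 - ε) ≥ 9ε/4`.
  have s1 := hgen (1 / 4) 1.38 (by linarith) (by rw [l4]; linarith)
  have hε8 : 1 - x i ≤ 1 / 8 := by nlinarith
  have s2 := hgen (1 / 8) 2 hε8 (by rw [l8]; linarith)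
  nlinarith

lemma vonNeumannEntropy_eq {n : Type*} [Fintype n] [DecidableEq n] {σ : Matrix n n ℂ}
    (hσ : σ.IsHermitian) :
    vonNeumannEntropy σ = -∑ j, hσ.eigenvalues j * Real.log (hσ.eigenvalues j) := by
  have hs : IsSelfAdjoint σ := hσ
  -- On a finite spectrum every function is continuous, including `log` at `0`.
  have hf := Matrix.finite_real_spectrum (A := σ)
  have : σ * cfc Real.log σ = cfc (fun x => x * Real.log x) σ := by
    rw [cfc_mul (fun x => x) Real.log σ continuousOn_id (hf.continuousOn _), cfc_id' ℝ σ]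
  rw [vonNeumannEntropy, this, hσ.cfc_eq, Matrix.IsHermitian.cfc,
    Unitary.conjStarAlgAut_apply, Matrix.trace_mul_cycle, Unitary.coe_star_mul_self, one_mul,
    Matrix.trace_diagonal]
  simp

/-- A density matrix has a rank-one spectral projection whose complementary weight is controlled
by the von Neumann entropy. -/
lemma exists_projection {n : Type*} [Fintype n] [DecidableEq n] {σ : Matrix n n ℂ}
    (hσ : IsDensityMatrix σ) : ∃ p : Matrix n n ℂ, p.PosSemidef ∧ p * p = p ∧ p.trace = 1 ∧
      (∀ A, p * A * p = (p * A).trace • p) ∧ σ * p = p * σ ∧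
      (1 ≤ 2 * √(vonNeumannEntropy σ) ∨
        3 * √((σ * (1 - p)).trace.re) ≤ 2 * √(vonNeumannEntropy σ)) := by
  have hH := hσ.posSemidef.1
  have hne : Nonempty n := by
    by_contra h
    rw [not_nonempty_iff] at h
    have := hσ.trace_eq_one
    simp [Matrix.trace] at this
  obtain ⟨i, hi⟩ := Finite.exists_max hH.eigenvalues
  set v : n → ℂ := WithLp.ofLp (hH.eigenvectorBasis i) with hv
  have hvv : star v ⬝ᵥ v = 1 := by
    have := hH.eigenvectorBasis.orthonormal.1 i
    rw [dotProduct_comm, ← EuclideanSpace.inner_eq_star_dotProduct, inner_self_eq_norm_sq_to_K,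
      this]
    simp
  have hσv : σ *ᵥ v = (hH.eigenvalues i : ℂ) • v := hH.mulVec_eigenvectorBasis i
  have hσv' : star v ᵥ* σ = (hH.eigenvalues i : ℂ) • star v := by
    have := congrArg star hσv
    rw [Matrix.star_mulVec, hH.eq] at this
    rw [this, star_smul]
    simp
  have hvv' : v ⬝ᵥ star v = 1 := by rw [dotProduct_comm, hvv]
  have hσp : σ * Matrix.vecMulVec v (star v) =
      (hH.eigenvalues i : ℂ) • Matrix.vecMulVec v (star v) := by
    rw [Matrix.mul_vecMulVec, hσv, Matrix.smul_vecMulVec]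
  refine ⟨Matrix.vecMulVec v (star v), Matrix.posSemidef_vecMulVec_self_star v, ?_, ?_, ?_, ?_, ?_⟩
  · rw [Matrix.vecMulVec_mul_vecMulVec, hvv, one_smul]
  · rw [Matrix.trace_vecMulVec, hvv']
  · intro A
    rw [Matrix.vecMulVec_mul, Matrix.vecMulVec_mul_vecMulVec, Matrix.trace_vecMulVec,
      dotProduct_comm v, Matrix.vecMulVec_smul]
  · rw [hσp, Matrix.vecMulVec_mul, hσv', Matrix.vecMulVec_smul]
  · have htr : (σ * (1 - Matrix.vecMulVec v (star v))).trace.re = 1 - hH.eigenvalues i := by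
      rw [mul_sub, mul_one, hσp, Matrix.trace_sub, hσ.trace_eq_one, Matrix.trace_smul,
        Matrix.trace_vecMulVec, hvv']
      simp
    have hsum : ∑ j, hH.eigenvalues j = 1 := by
      have := hH.trace_eq_sum_eigenvalues
      rw [hσ.trace_eq_one] at this
      simpa using (congrArg Complex.re this).symm
    have key := entropy_ge hσ.posSemidef.eigenvalues_nonneg hsum hi
    rw [← vonNeumannEntropy_eq hH] at key
    rw [htr]
    refine key.imp (fun h => ?_) (fun h => ?_)
    · have := Real.sqrt_le_sqrt h
      rw [show (1 / 4 : ℝ) = (1 / 2) ^ 2 by norm_num, Real.sqrt_sq (by norm_num)] at this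
      linarith
    · have := Real.sqrt_le_sqrt h
      rw [show (9 : ℝ) = 3 ^ 2 by norm_num, show (4 : ℝ) = 2 ^ 2 by norm_num,
        Real.sqrt_mul (by norm_num), Real.sqrt_mul (by norm_num), Real.sqrt_sq (by norm_num),
        Real.sqrt_sq (by norm_num)] at this
      exact this

/-! ### Covariances as inner products. -/

section Covariance

variable {n α : Type*} [Fintype n]

/-- The family `X a * S` as a Euclidean vector. For `ρ = S S†` the inner product of two such
vectors is `∑ₐ Tr[ρ Xₐ† Yₐ]`. -/
def hsVec (S : Matrix n n ℂ) (X : α → Matrix n n ℂ) : EuclideanSpace ℂ (α × n × n) :=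
  WithLp.toLp 2 fun x => (X x.1 * S) x.2.1 x.2.2

lemma hsVec_add (S : Matrix n n ℂ) (X Y : α → Matrix n n ℂ) :
    hsVec S (X + Y) = hsVec S X + hsVec S Y := by
  ext x
  simp [hsVec, add_mul]

lemma hsVec_sub (S : Matrix n n ℂ) (X Y : α → Matrix n n ℂ) :
    hsVec S (X - Y) = hsVec S X - hsVec S Y := by
  ext x
  simp [hsVec, sub_mul]

lemma hsVec_sum {κ : Type*} (s : Finset κ) (S : Matrix n n ℂ) (X : κ → α → Matrix n n ℂ) :
    hsVec S (fun a => ∑ k ∈ s, X k a) = ∑ k ∈ s, hsVec S (X k) := by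
  ext x
  simp [hsVec, Finset.sum_mul, Matrix.sum_apply]

variable [Fintype α]

lemma inner_hsVec (S : Matrix n n ℂ) (X Y : α → Matrix n n ℂ) :
    inner ℂ (hsVec S X) (hsVec S Y) = ∑ a, (S * Sᴴ * (X a)ᴴ * Y a).trace := by
  rw [PiLp.inner_apply, Fintype.sum_prod_type]
  refine Finset.sum_congr rfl fun a _ => ?_
  have : (S * Sᴴ * (X a)ᴴ * Y a).trace = ((X a * S)ᴴ * (Y a * S)).trace := by
    rw [Matrix.conjTranspose_mul, Matrix.mul_assoc S, Matrix.mul_assoc S, Matrix.trace_mul_comm,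
      Matrix.mul_assoc]
  rw [this, Fintype.sum_prod_type, Finset.sum_comm]
  simp only [Matrix.trace, Matrix.diag_apply, Matrix.mul_apply (M := (X a * S)ᴴ),
    Matrix.conjTranspose_apply, hsVec, RCLike.inner_apply, Complex.star_def]
  exact Finset.sum_congr rfl fun i _ => Finset.sum_congr rfl fun j _ => mul_comm _ _

lemma norm_hsVec_sq (S : Matrix n n ℂ) (X : α → Matrix n n ℂ) :
    ‖hsVec S X‖ ^ 2 = ∑ a, (S * Sᴴ * (X a)ᴴ * X a).trace.re := by
  rw [← Complex.re_sum, ← inner_hsVec]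
  exact (inner_self_eq_norm_sq (𝕜 := ℂ) _).symm

variable [DecidableEq n]

/-- If `∑ₐ Aₐ† Aₐ ≤ d`, then `∑ₐ Tr[ρ X† Aₐ† Aₐ X] ≤ d Tr[ρ X† X]`. -/
lemma norm_hsVec_mul_le {S : Matrix n n ℂ} {A : α → Matrix n n ℂ} {d : ℝ}
    (hA : ((d : ℂ) • (1 : Matrix n n ℂ) - ∑ a, (A a)ᴴ * A a).PosSemidef) (X : Matrix n n ℂ) :
    ‖hsVec S fun a => A a * X‖ ≤ √d * √((S * Sᴴ * Xᴴ * X).trace.re) := by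
  have hq : 0 ≤ (S * Sᴴ * Xᴴ * X).trace.re := by
    have := norm_hsVec_sq S fun _ : Unit => X
    rw [Fintype.sum_unique] at this
    exact this ▸ sq_nonneg _
  have h := (hA.conjTranspose_mul_mul_same (X * S)).trace_nonneg
  have e : ((X * S)ᴴ * ((d : ℂ) • (1 : Matrix n n ℂ) - ∑ a, (A a)ᴴ * A a) * (X * S)).trace =
      d * (S * Sᴴ * Xᴴ * X).trace - ∑ a, (S * Sᴴ * (A a * X)ᴴ * (A a * X)).trace := by
    have cyc : ∀ Y : Matrix n n ℂ, ((X * S)ᴴ * Y * (X * S)).trace =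
        (S * Sᴴ * Xᴴ * (Y * X)).trace := fun Y => by
      rw [Matrix.conjTranspose_mul, ← Matrix.mul_assoc, Matrix.trace_mul_comm]
      simp only [Matrix.mul_assoc]
    rw [cyc, sub_mul, mul_sub, Matrix.trace_sub, Matrix.smul_mul, Matrix.mul_smul,
      Matrix.trace_smul, one_mul, Finset.sum_mul, Finset.mul_sum, Matrix.trace_sum, smul_eq_mul]
    simp only [Matrix.conjTranspose_mul, Matrix.mul_assoc]
  rw [e] at h
  have h2 := (Complex.le_def.mp h).1
  rw [Complex.sub_re, Complex.re_ofReal_mul, Complex.re_sum, ← norm_hsVec_sq, Complex.zero_re] at h2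
  rw [← Real.sqrt_mul' _ hq]
  exact Real.le_sqrt_of_sq_le (by linarith)

/-- The family `Aₐ - Tr[ρ Aₐ]`. -/
def centered (ρ : Matrix n n ℂ) (A : α → Matrix n n ℂ) : α → Matrix n n ℂ :=
  fun a => A a - (ρ * A a).trace • (1 : Matrix n n ℂ)

/-- Since `B` is centered, it is orthogonal to scalars, so `A` may be shifted by any `c` and not
only by its mean. -/
lemma inner_centered {S : Matrix n n ℂ} (hS : (S * Sᴴ).trace = 1) (A B : α → Matrix n n ℂ)
    (c : α → ℂ) :
    inner ℂ (hsVec S fun a => A a - c a • (1 : Matrix n n ℂ))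
        (hsVec S (centered (S * Sᴴ) B)) =
      ∑ a, ((S * Sᴴ * (A a)ᴴ * B a).trace -
        star (S * Sᴴ * A a).trace * (S * Sᴴ * B a).trace) := by
  rw [inner_hsVec]
  refine Finset.sum_congr rfl fun a _ => ?_
  have hst : star (S * Sᴴ * A a).trace = (S * Sᴴ * (A a)ᴴ).trace := by
    rw [← Matrix.trace_conjTranspose, Matrix.conjTranspose_mul, Matrix.conjTranspose_mul,
      Matrix.conjTranspose_conjTranspose, Matrix.trace_mul_comm]
  rw [hst]
  simp only [centered, Matrix.conjTranspose_sub, Matrix.conjTranspose_smul,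
    Matrix.conjTranspose_one, mul_sub, sub_mul, Matrix.trace_sub, Matrix.mul_smul,
    Matrix.smul_mul, Matrix.trace_smul, mul_one, smul_eq_mul, hS]
  ring

lemma norm_hsVec_centered_sq {S : Matrix n n ℂ} (hS : (S * Sᴴ).trace = 1)
    (A : α → Matrix n n ℂ) :
    ‖hsVec S (centered (S * Sᴴ) A)‖ ^ 2 = ∑ a, variance (S * Sᴴ) (A a) := by
  have h := inner_centered hS A A fun a => (S * Sᴴ * A a).trace
  have h2 := inner_self_eq_norm_sq (𝕜 := ℂ) (hsVec S (centered (S * Sᴴ) A))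
  rw [← h2]
  refine (congrArg Complex.re h).trans ?_
  rw [Complex.re_sum]
  refine Finset.sum_congr rfl fun a _ => ?_
  rw [variance, Complex.sub_re, Complex.star_def, ← Complex.normSq_eq_conj_mul_self,
    Complex.ofReal_re, Complex.normSq_eq_norm_sq]

lemma norm_hsVec_centered_le {S : Matrix n n ℂ} (hS : (S * Sᴴ).trace = 1)
    {A : α → Matrix n n ℂ} {d : ℝ}
    (hA : ((d : ℂ) • (1 : Matrix n n ℂ) - ∑ a, (A a)ᴴ * A a).PosSemidef) :
    ‖hsVec S (centered (S * Sᴴ) A)‖ ≤ √d := by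
  have h1 := norm_hsVec_mul_le (S := S) hA 1
  simp only [mul_one, Matrix.conjTranspose_one, hS, Complex.one_re, Real.sqrt_one] at h1
  refine le_trans ?_ h1
  refine abs_le_of_sq_le_sq' ?_ (norm_nonneg _) |>.2
  rw [norm_hsVec_centered_sq hS, norm_hsVec_sq]
  exact Finset.sum_le_sum fun a _ => sub_le_self _ (sq_nonneg _)

/-- Variances are nonnegative, so squared means are bounded by second moments. -/
lemma sum_norm_trace_sq_le {S : Matrix n n ℂ} (hS : (S * Sᴴ).trace = 1)
    {A : α → Matrix n n ℂ} {d : ℝ} (hd : 0 ≤ d)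
    (hA : ((d : ℂ) • (1 : Matrix n n ℂ) - ∑ a, (A a)ᴴ * A a).PosSemidef) :
    ∑ a, ‖(S * Sᴴ * A a).trace‖ ^ 2 ≤ d := by
  have h0 := sq_nonneg ‖hsVec S (centered (S * Sᴴ) A)‖
  rw [norm_hsVec_centered_sq hS] at h0
  simp only [variance, Finset.sum_sub_distrib] at h0
  rw [← norm_hsVec_sq] at h0
  have h1 := norm_hsVec_mul_le (S := S) hA 1
  simp only [mul_one, Matrix.conjTranspose_one, hS, Complex.one_re, Real.sqrt_one] at h1
  have := pow_le_pow_left₀ (norm_nonneg _) h1 2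
  rw [Real.sq_sqrt hd] at this
  linarith

/-- The covariance of two families `A`, `B` is at most `3 √ε` times their norms, if a projection
`P` of expectation `1 - ε` that commutes with `B` compresses `A` to scalars. -/
lemma norm_inner_centered_le {S : Matrix n n ℂ} (hS : (S * Sᴴ).trace = 1)
    {A B : α → Matrix n n ℂ} {dA dB : ℝ} (hdA : 0 ≤ dA)
    (hA : ((dA : ℂ) • (1 : Matrix n n ℂ) - ∑ a, (A a)ᴴ * A a).PosSemidef)
    (hB : ((dB : ℂ) • (1 : Matrix n n ℂ) - ∑ a, (B a)ᴴ * B a).PosSemidef)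
    {P : Matrix n n ℂ} (hP : Pᴴ = P) (hPP : P * P = P) (hPB : ∀ a, Commute P (B a))
    {c : α → ℂ} (hc : ∀ a, P * A a * P = c a • P) (hcd : ∑ a, ‖c a‖ ^ 2 ≤ dA)
    (hPQ : ∀ a, (S * Sᴴ * P * (A a)ᴴ * (1 - P)).trace = 0) :
    ‖inner ℂ (hsVec S (centered (S * Sᴴ) A)) (hsVec S (centered (S * Sᴴ) B))‖ ≤
      3 * √((S * Sᴴ * (1 - P)).trace.re) * (√dA * √dB) := by
  set ρ := S * Sᴴ with hρ
  set Q := 1 - P with hQdef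
  have hQ : Qᴴ = Q := by simp [hQdef, hP]
  have hQQ : Q * Q = Q := by simp [hQdef, mul_sub, sub_mul, hPP]
  have hQB : ∀ a, Commute Q (B a) := fun a => (Commute.one_left _).sub_left (hPB a)
  set ε := (ρ * Q).trace.re with hε
  have eQ : (ρ * Qᴴ * Q).trace.re = ε := by rw [Matrix.mul_assoc, hQ, hQQ]
  have eP : (ρ * Pᴴ * P).trace.re = 1 - ε := by
    rw [Matrix.mul_assoc, hP, hPP, hε, hQdef, mul_sub, mul_one, Matrix.trace_sub, hS]
    simp
  have hε0 : 0 ≤ ε := by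
    have := norm_hsVec_sq S fun _ : Unit => Q
    rw [Fintype.sum_unique, ← hρ, eQ] at this
    exact this ▸ sq_nonneg _
  have nAP : ‖hsVec S fun a => A a * P‖ ≤ √dA := by
    refine (norm_hsVec_mul_le hA P).trans ?_
    rw [← hρ, eP]
    refine mul_le_of_le_one_right (Real.sqrt_nonneg _) ?_
    rw [Real.sqrt_le_one]
    linarith
  have nAQ : ‖hsVec S fun a => A a * Q‖ ≤ √dA * √ε := by
    simpa only [← hρ, eQ] using norm_hsVec_mul_le (S := S) hA Q
  have nBQ : ‖hsVec S fun a => B a * Q‖ ≤ √dB * √ε := by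
    simpa only [← hρ, eQ] using norm_hsVec_mul_le (S := S) hB Q
  have ncQ : ‖hsVec S fun a => c a • Q‖ ≤ √dA * √ε := by
    rw [← Real.sqrt_mul hdA]
    refine Real.le_sqrt_of_sq_le ?_
    rw [norm_hsVec_sq, ← hρ]
    refine le_trans (le_of_eq ?_) (mul_le_mul_of_nonneg_right hcd hε0)
    rw [Finset.sum_mul]
    refine Finset.sum_congr rfl fun a _ => ?_
    rw [Matrix.conjTranspose_smul, Matrix.mul_smul, Matrix.mul_smul, Matrix.smul_mul, smul_smul,
      Matrix.trace_smul, smul_eq_mul, Complex.star_def, Complex.mul_conj,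
      Complex.normSq_eq_norm_sq, Complex.re_ofReal_mul, eQ]
  have nB : ‖hsVec S (centered ρ B)‖ ≤ √dB := norm_hsVec_centered_le hS hB
  have hshift : inner ℂ (hsVec S (centered ρ A)) (hsVec S (centered ρ B)) =
      inner ℂ (hsVec S fun a => A a - c a • (1 : Matrix n n ℂ)) (hsVec S (centered ρ B)) := by
    rw [inner_centered hS A B c, ← inner_centered hS A B fun a => (ρ * A a).trace]
    rfl
  -- The compression `P A P = c P` cancels, and every remaining term carries a factor `Q`, of norm
  -- `√ε` in the state.
  have hdec : (fun a => A a - c a • (1 : Matrix n n ℂ)) =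
      (fun a => Q * A a * P) + ((fun a => A a * Q) - fun a => c a • Q) := by
    funext a
    simp only [Pi.add_apply, Pi.sub_apply, hQdef, sub_mul, mul_sub, one_mul, mul_one, hc, smul_sub]
    abel
  -- `Q` moves across the inner product and past `B`, where it acts on the state; `hPQ` removes the
  -- mean of `B`. This term costs one `√ε`, and `A Q` and `c Q` one each, whence the `3`.
  have hfirst : inner ℂ (hsVec S fun a => Q * A a * P) (hsVec S (centered ρ B)) =
      inner ℂ (hsVec S fun a => A a * P) (hsVec S fun a => B a * Q) := by
    rw [inner_hsVec, inner_hsVec]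
    refine Finset.sum_congr rfl fun a _ => ?_
    have := hPQ a
    simp only [centered, Matrix.conjTranspose_mul, hP, hQ, mul_sub, Matrix.trace_sub,
      Matrix.mul_smul, Matrix.trace_smul, mul_one]
    rw [← (hQB a).eq]
    simp only [← Matrix.mul_assoc, ← hρ]
    rw [this]
    simp
  rw [hshift, hdec, hsVec_add, inner_add_left, hfirst, hsVec_sub]
  have t1 := norm_inner_le_norm (𝕜 := ℂ) (hsVec S fun a => A a * P) (hsVec S fun a => B a * Q)
  have t2 := norm_inner_le_norm (𝕜 := ℂ)
    ((hsVec S fun a => A a * Q) - hsVec S fun a => c a • Q) (hsVec S (centered ρ B))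
  have t3 := norm_sub_le (hsVec S fun a => A a * Q) (hsVec S fun a => c a • Q)
  have t4 := mul_le_mul nAP nBQ (norm_nonneg _) (Real.sqrt_nonneg _)
  have t5 := mul_le_mul (t3.trans (add_le_add nAQ ncQ)) nB (norm_nonneg _) (by positivity)
  refine (norm_add_le _ _).trans ((add_le_add (t1.trans t4) (t2.trans t5)).trans (le_of_eq ?_))
  ring

end Covariance

/-! ### Summation over pairs of factors. -/

lemma sum_sqrt_le {N : ℕ} {x : Fin N → ℝ} (hx : ∀ k, 0 ≤ x k) : ∑ k, √(x k) ≤ N * √(avg x) := by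
  rcases N.eq_zero_or_pos with rfl | hN
  · simp
  have hN' : (0 : ℝ) < N := by exact_mod_cast hN
  have h := sq_sum_le_card_mul_sum_sq (s := Finset.univ) (f := fun k => √(x k))
  simp only [Real.sq_sqrt (hx _), Finset.card_univ, Fintype.card_fin] at h
  rw [← Real.sqrt_sq hN'.le, ← Real.sqrt_mul (sq_nonneg _)]
  refine Real.le_sqrt_of_sq_le (h.trans (le_of_eq ?_))
  rw [avg]
  field_simp

/-- The squared norm of a sum of vectors of squared norm at most `d k` whose pairwise inner products
are bounded by `2 √(s k) √(d k) √(d l)`. -/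
lemma norm_sum_sq_le {N : ℕ} {E : Type*} [NormedAddCommGroup E] [InnerProductSpace ℂ E]
    {u : Fin N → E} {d s : Fin N → ℝ} (hd : ∀ k, 0 ≤ d k) (hs : ∀ k, 0 ≤ s k)
    (hu : ∀ k, ‖u k‖ ≤ √(d k))
    (hne : ∀ k l, k ≠ l → ‖inner ℂ (u k) (u l)‖ ≤ 2 * √(s k) * (√(d k) * √(d l))) :
    ‖∑ k, u k‖ ^ 2 ≤ avg d * (N + 2 * (N : ℝ) ^ 2 * √(avg s)) := by
  rcases N.eq_zero_or_pos with rfl | hN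
  · simp
  have hN' : (0 : ℝ) < N := by exact_mod_cast hN
  have hpair : ∀ k l, ‖inner ℂ (u k) (u l)‖ ≤
      (if k = l then d k else 0) + (d k * √(s l) + d l * √(s k)) := by
    intro k l
    have hk := Real.sq_sqrt (hd k)
    have hl := Real.sq_sqrt (hd l)
    have hsk := Real.sqrt_nonneg (s k)
    have hsl := Real.sqrt_nonneg (s l)
    have am : √(d k) * √(d l) ≤ (d k + d l) / 2 := by
      nlinarith [sq_nonneg (√(d k) - √(d l))]
    rcases eq_or_ne k l with rfl | h
    · rw [if_pos rfl]
      have h1 := norm_inner_le_norm (𝕜 := ℂ) (u k) (u k)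
      have h2 := mul_le_mul (hu k) (hu k) (norm_nonneg _) (Real.sqrt_nonneg _)
      have h3 := mul_nonneg (hd k) hsk
      linarith
    · rw [if_neg h, zero_add]
      have h1 := hne k l h
      have h2 := hne l k h.symm
      rw [norm_inner_symm] at h2
      have h3 := mul_le_mul_of_nonneg_left am hsk
      have h4 := mul_le_mul_of_nonneg_left am hsl
      -- The hypothesis holds in both orders, so the smaller of the two entropies can be used: `(d k
      -- + d l) * min (√(s k)) (√(s l))` is at most the crossed sum, which factorizes on summation.
      rcases le_total (√(s k)) (√(s l)) with hle | hle
      · nlinarith [mul_le_mul_of_nonneg_left hle (hd k)]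
      · nlinarith [mul_le_mul_of_nonneg_left hle (hd l)]
  have hsum : ‖∑ k, u k‖ ^ 2 ≤ ∑ k, ∑ l, ‖inner ℂ (u k) (u l)‖ := by
    rw [← inner_self_eq_norm_sq (𝕜 := ℂ)]
    refine (RCLike.re_le_norm _).trans ?_
    rw [sum_inner]
    simp only [inner_sum]
    exact (norm_sum_le _ _).trans (Finset.sum_le_sum fun k _ => norm_sum_le _ _)
  refine hsum.trans ((Finset.sum_le_sum fun k _ => Finset.sum_le_sum fun l _ =>
    hpair k l).trans ?_)
  simp only [Finset.sum_add_distrib, Finset.sum_ite_eq, Finset.mem_univ, if_true]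
  rw [← Finset.sum_mul_sum, Finset.sum_comm (f := fun k l => d l * √(s k)), ← Finset.sum_mul_sum]
  have hD : 0 ≤ ∑ k, d k := Finset.sum_nonneg fun k _ => hd k
  have h := mul_le_mul_of_nonneg_left (sum_sqrt_le hs) hD
  have e : avg d * (N + 2 * (N : ℝ) ^ 2 * √(avg s)) =
      ∑ k, d k + 2 * ((∑ k, d k) * (N * √(avg s))) := by
    rw [avg]
    field_simp
  rw [e]
  linarith

lemma vonNeumannEntropy_nonneg {n : Type*} [Fintype n] [DecidableEq n] {σ : Matrix n n ℂ}
    (hσ : IsDensityMatrix σ) : 0 ≤ vonNeumannEntropy σ := by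
  have hH := hσ.posSemidef.1
  have h0 := hσ.posSemidef.eigenvalues_nonneg
  have hsum : ∑ j, hH.eigenvalues j = 1 := by
    have := hH.trace_eq_sum_eigenvalues
    rw [hσ.trace_eq_one] at this
    simpa using (congrArg Complex.re this).symm
  rw [vonNeumannEntropy_eq hH, ← Finset.sum_neg_distrib]
  refine Finset.sum_nonneg fun j _ => neg_nonneg.mpr (Real.mul_log_nonpos (h0 j) ?_)
  exact hsum ▸ Finset.single_le_sum (fun k _ => h0 k) (Finset.mem_univ j)

lemma sum_conjTranspose_mul_self_posSemidef {n α : Type*} [Fintype n] [Fintype α]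
    (A : α → Matrix n n ℂ) : (∑ a, (A a)ᴴ * A a).PosSemidef :=
  Matrix.posSemidef_sum Finset.univ fun a _ => Matrix.posSemidef_conjTranspose_mul_self (A a)

/-! ### Covariances of distinct tensor factors. -/

section Local

variable {N : ℕ} {ι : Fin N → Type*} [∀ k, Fintype (ι k)] [∀ k, DecidableEq (ι k)]
  {α : Type*} [Fintype α]

lemma smul_one_sub_sum_localOp_posSemidef (k : Fin N) (A : α → Matrix (ι k) (ι k) ℂ) :
    (((schattenInftyNorm (∑ a, (A a)ᴴ * A a) : ℝ) : ℂ) •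
      (1 : Matrix (∀ k, ι k) (∀ k, ι k) ℂ) -
        ∑ a, (localOp k (A a))ᴴ * localOp k (A a)).PosSemidef := by
  have h := localOp_posSemidef k (schattenInftyNorm_smul_one_sub_posSemidef
    (sum_conjTranspose_mul_self_posSemidef A))
  simpa only [localOp_sub, localOp_smul, localOp_one, localOp_sum, localOp_mul,
    localOp_conjTranspose] using h

/-- The covariance between two distinct factors is controlled by the entropy of the first. -/
lemma norm_inner_localOp_le {S : Matrix (∀ k, ι k) (∀ k, ι k) ℂ} (hS : IsDensityMatrix (S * Sᴴ))
    {k l : Fin N} (hkl : k ≠ l) (A : α → Matrix (ι k) (ι k) ℂ) (B : α → Matrix (ι l) (ι l) ℂ) :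
    ‖inner ℂ (hsVec S (centered (S * Sᴴ) fun a => localOp k (A a)))
        (hsVec S (centered (S * Sᴴ) fun a => localOp l (B a)))‖ ≤
      2 * √(vonNeumannEntropy (reducedState (S * Sᴴ) k)) *
        (√(schattenInftyNorm (∑ a, (A a)ᴴ * A a)) * √(schattenInftyNorm (∑ a, (B a)ᴴ * B a))) := by
  have hA := smul_one_sub_sum_localOp_posSemidef k A
  have hB := smul_one_sub_sum_localOp_posSemidef l B
  have hMA := sum_conjTranspose_mul_self_posSemidef A
  obtain ⟨p, hp, hpp, hptr, hpA, hσp, hcase⟩ := exists_projection (hS.reducedState k)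
  rcases hcase with hcase | hcase
  · refine (norm_inner_le_norm _ _).trans ?_
    refine (mul_le_mul (norm_hsVec_centered_le hS.trace_eq_one hA)
      (norm_hsVec_centered_le hS.trace_eq_one hB) (norm_nonneg _) (Real.sqrt_nonneg _)).trans ?_
    exact le_mul_of_one_le_left (by positivity) hcase
  · have hdA := schattenInftyNorm_nonneg hMA
    -- The projection is itself a pure state, in which the scalars `Tr[p A_a]` are means;
    -- `sum_norm_trace_sq_le` then bounds them.
    obtain ⟨T, rfl⟩ := exists_eq_mul_conjTranspose hp
    set p := T * Tᴴ
    have hL : localOp k (1 - p) = 1 - localOp k p := by rw [localOp_sub, localOp_one]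
    have key := norm_inner_centered_le (S := S) hS.trace_eq_one hdA hA hB (P := localOp k p)
      (by rw [← localOp_conjTranspose, hp.1.eq]) (by rw [← localOp_mul, hpp])
      (fun a => localOp_commute hkl _ _) (c := fun a => (p * A a).trace)
      (fun a => by rw [← localOp_mul, ← localOp_mul, hpA, localOp_smul])
      (sum_norm_trace_sq_le hptr hdA (schattenInftyNorm_smul_one_sub_posSemidef hMA))
      -- In the reduced state the trace cycles to one containing `(1 - p) ρ_k p = (1 - p) p ρ_k =
      -- 0`; here it matters that `p` is a spectral projection.
      (fun a => by
        rw [← hL, ← localOp_conjTranspose, Matrix.mul_assoc, Matrix.mul_assoc, ← localOp_mul,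
          ← localOp_mul, trace_mul_localOp, ← Matrix.mul_assoc, ← Matrix.mul_assoc,
          Matrix.trace_mul_comm, ← Matrix.mul_assoc, hσp, ← Matrix.mul_assoc, sub_mul, one_mul,
          hpp, sub_self]
        simp)
    rw [← hL, trace_mul_localOp] at key
    exact key.trans (mul_le_mul_of_nonneg_right hcase (by positivity))

end Local

end MultipartiteQuantum

end

open MultipartiteQuantum in
open scoped Matrix in
theorem mainTheorem8 {N : ℕ} (ι : Fin N → Type*) [∀ k, Fintype (ι k)] [∀ k, DecidableEq (ι k)]
    {α : Type*} [Fintype α] (G : ∀ k : Fin N, α → Matrix (ι k) (ι k) ℂ)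
    (ρ : Matrix (∀ k, ι k) (∀ k, ι k) ℂ) (hρ : IsDensityMatrix ρ) :
    ∑ a, variance ρ (∑ k, localOp k (G k a)) ≤
      avg (fun k => schattenInftyNorm (∑ a, (G k a)ᴴ * G k a)) *
        (N + 2 * (N : ℝ) ^ 2 * √(avg fun k => vonNeumannEntropy (reducedState ρ k))) := by
  obtain ⟨S, rfl⟩ := exists_eq_mul_conjTranspose hρ.posSemidef
  have hsum : hsVec S (centered (S * Sᴴ) fun a => ∑ k, localOp k (G k a)) =
      ∑ k, hsVec S (centered (S * Sᴴ) fun a => localOp k (G k a)) := by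
    rw [← hsVec_sum]
    congr 1
    funext a
    simp only [centered, Finset.mul_sum, Matrix.trace_sum, Finset.sum_smul,
      Finset.sum_sub_distrib]
  rw [← norm_hsVec_centered_sq hρ.trace_eq_one, hsum]
  refine norm_sum_sq_le (fun k => schattenInftyNorm_nonneg (sum_conjTranspose_mul_self_posSemidef (G k)))
    (fun k => vonNeumannEntropy_nonneg (hρ.reducedState k)) (fun k => ?_) (fun k l hkl => ?_)
  · exact norm_hsVec_centered_le hρ.trace_eq_one (smul_one_sub_sum_localOp_posSemidef k _)
  · exact norm_inner_localOp_le hρ hkl _ _
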